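/- Let $(X,\rho)$ be a metric space with open balls $B(x,r)$, and let $\mu$ be a Borel measure on $X$ that is doubling: for some constant $C$, $0<\mu(B(x,2r))\le C\mu(B(x,r))<\infty$ for all $x\in X$, $r>0$. Put $V(x,r)=\mu(B(x,r))$, $V(x,y)=V(x,\rho(x,y))$ for $x\ne y$, and $V(x,x)=\mu(\{x\})$. Let $d\in[1,\infty)$, $\varepsilon\in[0,1-\frac1d]$, $\alpha=\varepsilon d$, and $p=\frac{d}{1+\varepsilon d}=\frac{d}{1+\alpha}$. Assume that 1. $X$ has lower dimension $d$: there is a constant $c>0$ such that $\frac{V(x,R)}{V(x,r)}\ge c\,(\frac Rr)^d$ for all $x\in X$ and $0<r\le R<\infty$; 2. $X$ satisfies the $(1,p)$-Poincaré inequality: there are $\lambda\ge1$ and $c_P<\infty$ such that, for every Lipschitz function $f:X\to\mathbb R$, every $x\in X$ and $r>0$, with $\langle g\rangle_B=\frac1{\mu(B)}\int_B g\,d\mu$ the average over a ball, $$\Big\langle|f-\langle f\rangle_{B(x,r)}|\Big\rangle_{B(x,r)}\le c_P\, r\,\Big(\big\langle(\operatorname{lip}f)^p\big\rangle_{B(x,\lambda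 r)}\Big)^{1/p},\qquad \operatorname{lip}f(x)=\liminf_{r\to0^+}\sup_{\rho(x,y)\le r}\frac{|f(x)-f(y)|}{r}.$$ Let either $\phi(x,y)=V(x,y)^\varepsilon$ for all $x,y$, or $\phi(x,y)=\rho(x,y)^\alpha$ for all $x,y$. Denote by $L^1_{\rm loc}(\mu)$ the functions integrable over every ball of $X$, and by $L^1_{\rm loc}(\mu\times\mu)$ the functions on $X\times X$ integrable over every product $B(x,r)\times B(y,r)$ of balls; quotients $0/0$ are read as $0$. If a complex-valued function $b\in L^1_{\rm loc}(\mu)$ satisfies $$\Big[(x,y)\mapsto\frac{|b(x)-b(y)|^p}{V(x,y)^2}\phi(x,y)^p\Big]\in L^1_{\rm loc}(\mu\times\mu),$$ then $b$ is equal to a constant $\mu$-almost everywhere. In particular, $$\mathbb B_{p}(\phi,\mu)=\dot B_{p}^{1/d}(\mu)=\widetilde B_{p}^{\alpha}(\mu)=\{\text{functions equal to a constant a.e.}\},$$ where these spaces consist of all $b\in L^1_{\rm loc}(\mu)$ for which, respectively, the following is finite: $$\Big(\int_X\int_X\frac{|b(x)-b(y)|^p}{V(x,y)^2}\phi(x,y)^p\,d\mu(x)d\mu(y)\Big)^{1/p},\quad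 \Big(\int_X\int_X\frac{|b(x)-b(y)|^p}{V(x,y)^{1+p/d}}\,d\mu(x)d\mu(y)\Big)^{1/p},\quad \Big(\int_X\int_X\frac{|b(x)-b(y)|^p}{V(x,y)^2}\rho(x,y)^{p\alpha}\,d\mu(x)d\mu(y)\Big)^{1/p}.$$ -/

import Mathlib

open MeasureTheory Metric Filter Topology
open scoped ENNReal NNReal

namespace FractionalBesov

/-- `μ` is a doubling measure on the metric space `X`: `0 < μ(2B) ≤ C μ(B) < ∞` for all balls `B`. -/
def IsDoubling {X : Type*} [MetricSpace X] [MeasurableSpace X] (μ : Measure X) : Prop :=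
  ∃ C : ℝ≥0, ∀ (x : X) (r : ℝ), 0 < r →
    0 < μ (ball x (2 * r)) ∧ μ (ball x (2 * r)) ≤ C * μ (ball x r) ∧ C * μ (ball x r) < ∞

/-- Lower dimension `d`: `V(x,R) / V(x,r) ≥ c (R/r)^d` for all `x` and `0 < r ≤ R < ∞`,
where `V(x,r) = μ(B(x,r))` and `c > 0` is a constant. -/
def HasLowerDim {X : Type*} [MetricSpace X] [MeasurableSpace X] (μ : Measure X) (d : ℝ) : Prop :=
  ∃ c : ℝ, 0 < c ∧ ∀ (x : X) (r R : ℝ), 0 < r → r ≤ R →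
    c * (R / r) ^ d ≤ μ.real (ball x R) / μ.real (ball x r)

/-- The pointwise Lipschitz constant
`lip f (x) = liminf_{r → 0+} sup_{ρ(x,y) ≤ r} |f x - f y| / r`, with values in `[0, ∞]`. -/
noncomputable def lip {X : Type*} [MetricSpace X] (f : X → ℝ) (x : X) : ℝ≥0∞ :=
  liminf (fun r : ℝ => ⨆ y ∈ closedBall x r, ENNReal.ofReal (|f x - f y| / r)) (𝓝[>] 0)

/-- The `(1,s)`-Poincaré inequality. -/
def HasPoincare {X : Type*} [MetricSpace X] [MeasurableSpace X] (μ : Measure X) (s : ℝ) : Prop :=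
  ∃ (lam : ℝ) (c : ℝ≥0), 1 ≤ lam ∧
    ∀ f : X → ℝ, (∃ K : ℝ≥0, LipschitzWith K f) → ∀ (x : X) (r : ℝ), 0 < r →
      ENNReal.ofReal (⨍ y in ball x r, |f y - ⨍ z in ball x r, f z ∂μ| ∂μ) ≤
        c * ENNReal.ofReal r * (⨍⁻ y in ball x (lam * r), lip f y ^ s ∂μ) ^ (1 / s)

/-- Local integrability on a metric space: integrability over every ball (equivalently, over
every bounded measurable set). On a product with its maximum metric, the balls are the sets
`B(x,r) × B(y,r)`. -/
def LocInt {X E : Type*} [PseudoMetricSpace X] [MeasurableSpace X] [NormedAddCommGroup E]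
    (f : X → E) (μ : Measure X) : Prop :=
  ∀ (x : X) (r : ℝ), IntegrableOn f (ball x r) μ

open Classical in
/-- `V(x,y) = μ(B(x, ρ(x,y)))` for `x ≠ y`, and `V(x,x) = μ({x})`. -/
noncomputable def V {X : Type*} [MetricSpace X] [MeasurableSpace X] (μ : Measure X)
    (x y : X) : ℝ :=
  if x = y then μ.real {x} else μ.real (ball x (dist x y))

/-- The volumic choice `φ(x,y) = V(x,y)^ε`. -/
noncomputable def phiVol {X : Type*} [MetricSpace X] [MeasurableSpace X] (μ : Measure X)
    (ε : ℝ) (x y : X) : ℝ :=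
  V μ x y ^ ε

/-- The metric choice `φ(x,y) = ρ(x,y)^α`. -/
noncomputable def phiMet {X : Type*} [MetricSpace X] (α : ℝ) (x y : X) : ℝ :=
  dist x y ^ α

/-- The (semi)norm `(∫∫ |b(x)-b(y)|^p / V(x,y)^2 · φ(x,y)^p dμ(x) dμ(y))^{1/p}`. -/
noncomputable def normB {X : Type*} [MetricSpace X] [MeasurableSpace X] (μ : Measure X)
    (p : ℝ) (φ : X → X → ℝ) (b : X → ℂ) : ℝ≥0∞ :=
  (∫⁻ y, ∫⁻ x, ENNReal.ofReal (‖b x - b y‖ ^ p / V μ x y ^ 2 * φ x y ^ p) ∂μ ∂μ) ^ (1 / p)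

/-- The (semi)norm `(∫∫ |b(x)-b(y)|^p / V(x,y)^{1+ps} dμ(x) dμ(y))^{1/p}`. -/
noncomputable def normDotB {X : Type*} [MetricSpace X] [MeasurableSpace X] (μ : Measure X)
    (p s : ℝ) (b : X → ℂ) : ℝ≥0∞ :=
  (∫⁻ y, ∫⁻ x, ENNReal.ofReal (‖b x - b y‖ ^ p / V μ x y ^ (1 + p * s)) ∂μ ∂μ) ^ (1 / p)

/-- The (semi)norm `(∫∫ |b(x)-b(y)|^p / V(x,y)^2 · ρ(x,y)^{pα} dμ(x) dμ(y))^{1/p}`. -/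
noncomputable def normTildeB {X : Type*} [MetricSpace X] [MeasurableSpace X] (μ : Measure X)
    (p α : ℝ) (b : X → ℂ) : ℝ≥0∞ :=
  (∫⁻ y, ∫⁻ x, ENNReal.ofReal (‖b x - b y‖ ^ p / V μ x y ^ 2 * dist x y ^ (p * α)) ∂μ ∂μ)
    ^ (1 / p)

/-- The space `𝔹_p(φ,μ)`. -/
def spaceB {X : Type*} [MetricSpace X] [MeasurableSpace X] (μ : Measure X)
    (p : ℝ) (φ : X → X → ℝ) : Set (X → ℂ) :=
  {b | LocInt b μ ∧ normB μ p φ b < ∞}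

/-- The volumic Besov space with integrability `p` and smoothness `s`. -/
def spaceDotB {X : Type*} [MetricSpace X] [MeasurableSpace X] (μ : Measure X)
    (p s : ℝ) : Set (X → ℂ) :=
  {b | LocInt b μ ∧ normDotB μ p s b < ∞}

/-- The metric Besov space with parameters `p` and `α`. -/
def spaceTildeB {X : Type*} [MetricSpace X] [MeasurableSpace X] (μ : Measure X)
    (p α : ℝ) : Set (X → ℂ) :=
  {b | LocInt b μ ∧ normTildeB μ p α b < ∞}

/-- The functions that agree almost everywhere with a constant. -/
def aeConstants {X : Type*} [MeasurableSpace X] (μ : Measure X) : Set (X → ℂ) :=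
  {b | ∃ c : ℂ, b =ᵐ[μ] fun _ => c}

end FractionalBesov

/-! The weight is critical. The lower dimension gives locally `V ≤ A (φ ρ)^p`
(`IsDoubling.exists_V_le`), so the kernel dominates a constant times `(|b(x)-b(y)|/ρ)^p / V`, a
difference quotient of full order one with no decay to spare. By Jensen, the `p`-th power of `t⁻¹
⨍_{B(y,t)} |b - b(y)|` is bounded by the integral of the kernel over `B(y,t)`. Integrating in `y`
leaves an integrable kernel restricted to the strip `ρ < t`, which tends to `0` with `t`
(`IsDoubling.tendsto_lintegral_meanDist`).

These quotients control a gradient: averaging `b` against tents of radius comparable to `t` gives a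
Lipschitz function whose `lip` is bounded by them, and whose distance to `b` is at most `t` times
them (`IsDoubling.exists_lipschitz_approx`). The Poincaré inequality for the approximants then
forces the mean oscillation of `b` on every ball to be zero
(`HasPoincare.ae_eq_average_of_tendsto`). -/

namespace FractionalBesov

/-! ### Balls and separability in doubling spaces -/

section Doubling

variable {X : Type*} [MetricSpace X] [MeasurableSpace X] {μ : Measure X}

theorem IsDoubling.measure_ball_pos (h : IsDoubling μ) (x : X) {r : ℝ} (hr : 0 < r) :
    0 < μ (ball x r) := by
  obtain ⟨C, hC⟩ := h
  have := (hC x (r / 2) (by positivity)).1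
  rwa [mul_div_cancel₀ r two_ne_zero] at this

theorem IsDoubling.measure_ball_lt_top (h : IsDoubling μ) (x : X) (r : ℝ) :
    μ (ball x r) < ∞ := by
  rcases le_or_gt r 0 with hr | hr
  · simp [ball_eq_empty.2 hr]
  · obtain ⟨C, hC⟩ := h
    obtain ⟨-, h2, h3⟩ := hC x (r / 2) (by positivity)
    rw [mul_div_cancel₀ r two_ne_zero] at h2
    exact h2.trans_lt h3

theorem IsDoubling.measureReal_ball_pos (h : IsDoubling μ) (x : X) {r : ℝ} (hr : 0 < r) :
    0 < μ.real (ball x r) :=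
  ENNReal.toReal_pos (h.measure_ball_pos x hr).ne' (h.measure_ball_lt_top x r).ne

theorem IsDoubling.measureReal_ball_mono (h : IsDoubling μ) {x y : X} {r s : ℝ}
    (hs : dist x y + r ≤ s) : μ.real (ball x r) ≤ μ.real (ball y s) :=
  measureReal_mono (ball_subset_ball' (by linarith)) (h.measure_ball_lt_top y s).ne

/-- A doubling measure has a doubling constant that is at least one. -/
theorem IsDoubling.exists_const (h : IsDoubling μ) :
    ∃ C : ℝ, 1 ≤ C ∧ ∀ (x : X) (r : ℝ), 0 < r →
      μ.real (ball x (2 * r)) ≤ C * μ.real (ball x r) := by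
  have h' := h
  obtain ⟨C, hC⟩ := h
  refine ⟨max 1 C, le_max_left _ _, fun x r hr => ?_⟩
  obtain ⟨-, h2, h3⟩ := hC x r hr
  have h4 := ENNReal.toReal_mono h3.ne h2
  rw [ENNReal.toReal_mul, ENNReal.coe_toReal] at h4
  exact h4.trans (mul_le_mul_of_nonneg_right (le_max_right _ _) measureReal_nonneg)

theorem IsDoubling.measureReal_ball_pow_le {C : ℝ} (hC1 : 1 ≤ C)
    (hC : ∀ (x : X) (r : ℝ), 0 < r → μ.real (ball x (2 * r)) ≤ C * μ.real (ball x r))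
    (n : ℕ) (x : X) {r : ℝ} (hr : 0 < r) :
    μ.real (ball x (2 ^ n * r)) ≤ C ^ n * μ.real (ball x r) := by
  induction n with
  | zero => simp
  | succ n ih =>
    calc μ.real (ball x (2 ^ (n + 1) * r)) = μ.real (ball x (2 * (2 ^ n * r))) := by
          rw [pow_succ]; ring_nf
      _ ≤ C * μ.real (ball x (2 ^ n * r)) := hC _ _ (by positivity)
      _ ≤ C * (C ^ n * μ.real (ball x r)) := by gcongr
      _ = _ := by ring

theorem IsDoubling.sigmaFinite (h : IsDoubling μ) : SigmaFinite μ := by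
  rcases isEmpty_or_nonempty X with hX | ⟨⟨x₀⟩⟩
  · rw [Measure.eq_zero_of_isEmpty μ]; infer_instance
  · exact ⟨⟨{ set := fun n : ℕ => ball x₀ n
              set_mem := fun _ => trivial
              finite := fun n => h.measure_ball_lt_top x₀ n
              spanning := iUnion_ball_nat x₀ }⟩⟩

/-- A metric space that carries a doubling measure is separable. -/
theorem IsDoubling.secondCountableTopology [BorelSpace X] (h : IsDoubling μ) :
    SecondCountableTopology X := by
  have := h.sigmaFinite
  refine Metric.secondCountable_of_almost_dense_set fun ε hε => ?_
  -- A maximal `ε`-separated set is `ε`-dense. It is countable because the balls of radius `ε / 2`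
  -- about its points are disjoint and of positive measure, and `μ` is σ-finite.
  obtain ⟨N, hN⟩ := zorn_subset {N : Set X | N.Pairwise fun x y => ε < dist x y} (by
    intro c hc hchain
    exact ⟨⋃₀ c, (Set.pairwise_sUnion hchain.directedOn).2 hc,
      fun s hs => Set.subset_sUnion_of_mem hs⟩)
  refine ⟨N, ?_, fun x => ?_⟩
  · have hdisj : Pairwise (Function.onFun Disjoint fun y : N => ball (y : X) (ε / 2)) := by
      intro y z hyz
      refine ball_disjoint_ball ?_
      have := hN.prop y.2 z.2 (fun hh => hyz (Subtype.ext hh))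
      linarith
    have hcount := Measure.countable_meas_pos_of_disjoint_iUnion (μ := μ)
      (fun y : N => measurableSet_ball (x := (y : X)) (ε := ε / 2)) hdisj
    have huniv : {y : N | 0 < μ (ball (y : X) (ε / 2))} = Set.univ :=
      Set.eq_univ_of_forall fun y => h.measure_ball_pos _ (by positivity)
    rw [huniv, Set.countable_univ_iff] at hcount
    exact Set.countable_coe_iff.1 hcount
  · by_contra! hx
    have hins : insert x N ∈ {N : Set X | N.Pairwise fun x y => ε < dist x y} := by
      refine hN.prop.insert fun y hy _ => ⟨hx y hy, ?_⟩
      rw [dist_comm]; exact hx y hy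
    have hxN : x ∈ N := hN.le_of_ge hins (Set.subset_insert x N) (Set.mem_insert x N)
    have := hx x hxN
    rw [dist_self] at this
    linarith

end Doubling

end FractionalBesov

/-! ### Averages against tent functions -/

namespace FractionalBesov

/-- Integration against a bounded kernel supported in a ball. -/
theorem abs_integral_mul_le {Y : Type*} [MeasurableSpace Y] {μ : Measure Y}
    {k b : Y → ℝ} {B : Set Y} {c : ℝ}
    (hk : ∀ x, |k x| ≤ c) (hk0 : ∀ x ∉ B, k x = 0) (hb : IntegrableOn b B μ) :
    |∫ x, k x * b x ∂μ| ≤ c * ∫ x in B, |b x| ∂μ := by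
  rw [← setIntegral_eq_integral_of_forall_compl_eq_zero (s := B)
    (f := fun x => k x * b x) (fun x hx => by rw [hk0 x hx, zero_mul]), 
    ← integral_const_mul (μ := μ.restrict B) c]
  rw [← Real.norm_eq_abs]
  refine norm_integral_le_of_norm_le (hb.abs.const_mul c) (ae_of_all _ fun x => ?_)
  rw [Real.norm_eq_abs, abs_mul]
  exact mul_le_mul_of_nonneg_right (hk x) (abs_nonneg _)

section TentAverage

variable {X : Type*} [MetricSpace X]

/-- The tent function of radius `t` centred at `y`. -/
noncomputable def tent (t : ℝ) (y x : X) : ℝ := max 0 (1 - dist x y / t)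

theorem tent_nonneg (t : ℝ) (y x : X) : 0 ≤ tent t y x := le_max_left _ _

theorem tent_le_one {t : ℝ} (ht : 0 < t) (y x : X) : tent t y x ≤ 1 :=
  max_le zero_le_one (by linarith [div_nonneg (dist_nonneg (x := x) (y := y)) ht.le])

theorem tent_eq_zero {t : ℝ} (ht : 0 < t) {y x : X} (h : x ∉ ball y t) : tent t y x = 0 := by
  rw [mem_ball, not_lt] at h
  exact max_eq_left (by linarith [(one_le_div ht).2 h])

theorem half_le_tent {t : ℝ} (ht : 0 < t) {y x : X} (h : x ∈ ball y (t / 2)) :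
    1 / 2 ≤ tent t y x := by
  rw [mem_ball] at h
  refine le_max_of_le_right ?_
  have : dist x y / t ≤ 1 / 2 := by rw [div_le_iff₀ ht]; linarith
  linarith

/-- This Lipschitz dependence on the centre is the reason for tents: averages over balls need not be
continuous in the centre. -/
theorem abs_tent_sub_le {t : ℝ} (ht : 0 < t) (y y' x : X) :
    |tent t y x - tent t y' x| ≤ dist y y' / t := by
  refine (abs_max_sub_max_le_max _ _ _ _).trans (max_le (by simp; positivity) ?_)
  have : 1 - dist x y / t - (1 - dist x y' / t) = (dist x y' - dist x y) / t := by ring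
  rw [this, abs_div, abs_of_pos ht]
  gcongr
  rw [dist_comm x y', dist_comm x y, abs_sub_comm]
  exact abs_dist_sub_le y y' x

theorem continuous_tent (t : ℝ) (y : X) : Continuous (tent t y) := by
  unfold tent; fun_prop

variable [MeasurableSpace X] {μ : Measure X}

theorem IsDoubling.locInt_const {E : Type*} [NormedAddCommGroup E] (h : IsDoubling μ) (c : E) :
    LocInt (fun _ : X => c) μ :=
  fun x r => integrableOn_const (h.measure_ball_lt_top x r).ne

theorem LocInt.sub {E : Type*} [NormedAddCommGroup E] {f g : X → E} (hf : LocInt f μ)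
    (hg : LocInt g μ) : LocInt (fun x => f x - g x) μ :=
  fun x r => (hf x r).sub (hg x r)

variable [BorelSpace X]

/-- The average of `b` with respect to the tent function of radius `t` centred at `y`. -/
noncomputable def tentAverage (μ : Measure X) (t : ℝ) (b : X → ℝ) (y : X) : ℝ :=
  (∫ x, tent t y x * b x ∂μ) / ∫ x, tent t y x ∂μ

theorem integrable_tent_mul {t : ℝ} (ht : 0 < t) {b : X → ℝ} (hb : LocInt b μ) (y : X) :
    Integrable (fun x => tent t y x * b x) μ := by
  refine IntegrableOn.integrable_of_forall_notMem_eq_zero (s := ball y t) ?_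
    fun x hx => by rw [tent_eq_zero ht hx, zero_mul]
  refine Integrable.bdd_mul (c := 1) (hb y t) ?_ (ae_of_all _ fun x => ?_)
  · exact (continuous_tent t y).measurable.aestronglyMeasurable
  · rw [Real.norm_of_nonneg (tent_nonneg _ _ _)]
    exact tent_le_one ht y x

theorem integrable_tent (h : IsDoubling μ) {t : ℝ} (ht : 0 < t) (y : X) :
    Integrable (tent t y) μ := by
  simpa only [mul_one] using integrable_tent_mul ht (h.locInt_const (1 : ℝ)) y

theorem half_measure_le_integral_tent (h : IsDoubling μ) {t : ℝ} (ht : 0 < t) (y : X) :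
    μ.real (ball y (t / 2)) / 2 ≤ ∫ x, tent t y x ∂μ := by
  calc μ.real (ball y (t / 2)) / 2 = ∫ _ in ball y (t / 2), (1 / 2 : ℝ) ∂μ := by
        rw [setIntegral_const, smul_eq_mul]; ring
    _ ≤ ∫ x in ball y (t / 2), tent t y x ∂μ :=
        setIntegral_mono_on (h.locInt_const _ y _) (integrable_tent h ht y).integrableOn
          measurableSet_ball fun x hx => half_le_tent ht hx
    _ ≤ ∫ x, tent t y x ∂μ :=
        setIntegral_le_integral (integrable_tent h ht y) (ae_of_all _ (tent_nonneg t y))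

theorem integral_tent_pos (h : IsDoubling μ) {t : ℝ} (ht : 0 < t) (y : X) :
    0 < ∫ x, tent t y x ∂μ :=
  (half_pos (h.measureReal_ball_pos y (half_pos ht))).trans_le
    (half_measure_le_integral_tent h ht y)

theorem integral_tent_mul_sub (h : IsDoubling μ) {t : ℝ} (ht : 0 < t) {b : X → ℝ}
    (hb : LocInt b μ) (y : X) (m : ℝ) :
    ∫ x, tent t y x * (b x - m) ∂μ = (∫ x, tent t y x ∂μ) * (tentAverage μ t b y - m) := by
  have h1 : ∫ x, tent t y x * (b x - m) ∂μ =
      ∫ x, tent t y x * b x ∂μ - ∫ x, tent t y x * m ∂μ := by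
    rw [← integral_sub (integrable_tent_mul ht hb y) ((integrable_tent h ht y).mul_const m)]
    simp_rw [mul_sub]
  rw [h1, integral_mul_const, tentAverage, mul_sub,
    mul_div_cancel₀ _ (integral_tent_pos h ht y).ne']

theorem abs_tentAverage_sub_const_le (h : IsDoubling μ) {t : ℝ} (ht : 0 < t) {b : X → ℝ}
    (hb : LocInt b μ) {y y' : X} (hy : dist y y' < t) (m : ℝ) :
    |tentAverage μ t b y' - m| ≤
      (∫ x in ball y (2 * t), |b x - m| ∂μ) / ∫ x, tent t y' x ∂μ := by
  have hW := integral_tent_pos h ht y'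
  rw [le_div_iff₀ hW]
  have h1 := abs_integral_mul_le (μ := μ) (k := tent t y') (b := fun x => b x - m)
    (B := ball y (2 * t)) (c := 1)
    (fun x => by rw [abs_of_nonneg (tent_nonneg _ _ _)]; exact tent_le_one ht _ _)
    (fun x hx => tent_eq_zero ht fun hx' => hx <| ball_subset_ball' (by
      rw [dist_comm]; linarith) hx')
    ((hb y _).sub (h.locInt_const m y _))
  rw [integral_tent_mul_sub h ht hb, abs_mul, abs_of_pos hW] at h1
  linarith

/-- For `m` the average at `y'`, the integral of `tent t y' * (b - m)` vanishes by
`integral_tent_mul_sub`. Only the difference of the two tents has to be estimated, and the two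
normalizing integrals are never compared. -/
theorem abs_tentAverage_sub_le (h : IsDoubling μ) {t : ℝ} (ht : 0 < t) {b : X → ℝ}
    (hb : LocInt b μ) {y y' : X} (hy : dist y y' < t) :
    |tentAverage μ t b y - tentAverage μ t b y'| ≤ dist y y' / t *
      (∫ x in ball y (2 * t), |b x - tentAverage μ t b y'| ∂μ) / ∫ x, tent t y x ∂μ := by
  have hW := integral_tent_pos h ht y
  rw [le_div_iff₀ hW]
  set m := tentAverage μ t b y' with hm
  have hbm : LocInt (fun x => b x - m) μ := hb.sub (h.locInt_const m)
  have h1 := abs_integral_mul_le (μ := μ) (k := fun x => tent t y x - tent t y' x)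
    (b := fun x => b x - m)
    (B := ball y (2 * t)) (c := dist y y' / t)
    (fun x => abs_tent_sub_le ht y y' x)
    (fun x hx => by
      rw [tent_eq_zero ht, tent_eq_zero ht, sub_zero]
      · exact fun hx' => hx <| ball_subset_ball' (by rw [dist_comm]; linarith) hx'
      · exact fun hx' => hx <| ball_subset_ball (by linarith) hx')
    (hbm y _)
  have h2 : ∫ x, (tent t y x - tent t y' x) * (b x - m) ∂μ =
      (∫ x, tent t y x ∂μ) * (tentAverage μ t b y - m) := by
    simp_rw [sub_mul]
    rw [integral_sub (integrable_tent_mul ht hbm y) (integrable_tent_mul ht hbm y'),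
      integral_tent_mul_sub h ht hb, integral_tent_mul_sub h ht hb, ← hm, sub_self, mul_zero,
      sub_zero]
  rw [h2, abs_mul, abs_of_pos hW] at h1
  linarith

/-- Tent averages approximate `b`, and are Lipschitz at small scales, with bounds in terms of the
mean oscillation of `b`. -/
theorem IsDoubling.exists_tentAverage_bound (h : IsDoubling μ) :
    ∃ L : ℝ, 0 ≤ L ∧ ∀ (t : ℝ), 0 < t → ∀ b : X → ℝ, LocInt b μ → ∀ (y y' : X), dist y y' < t →
      ∀ m : ℝ,
        |tentAverage μ t b y' - m| ≤ L * ⨍ x in ball y (2 * t), |b x - m| ∂μ ∧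
        |tentAverage μ t b y - tentAverage μ t b y'| ≤
          dist y y' / t * (L * ⨍ x in ball y (2 * t), |b x - m| ∂μ) := by
  obtain ⟨C, hC1, hC⟩ := h.exists_const
  have hC0 : 0 ≤ C := zero_le_one.trans hC1
  -- The factor `2 * C ^ 3` compares `μ(B(y,2t))` with the integral of a tent centred at `z`,
  -- `ρ(y,z) < t`: the tent is at least `1/2` on `B(z,t/2)`, and `B(y,2t) ⊆ B(z,4t)`, three
  -- doublings away. The factor `1 + 2 * C ^ 3` pays for replacing `m` by the average at `y'`.
  refine ⟨(1 + 2 * C ^ 3) * (2 * C ^ 3), by positivity, fun t ht b hb y y' hy m => ?_⟩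
  set L := 2 * C ^ 3 with hL
  have hL0 : 0 ≤ L := by positivity
  have hV := h.measureReal_ball_pos y (r := 2 * t) (by positivity)
  set v := μ.real (ball y (2 * t)) with hv
  have hlow : ∀ z : X, dist y z < t → v ≤ L * ∫ x, tent t z x ∂μ := by
    intro z hz
    have h1 : v ≤ μ.real (ball z (2 ^ 3 * (t / 2))) := h.measureReal_ball_mono (by linarith)
    have h2 := IsDoubling.measureReal_ball_pow_le hC1 hC 3 z (half_pos ht)
    have h3 := half_measure_le_integral_tent h ht z
    have h4 : C ^ 3 * μ.real (ball z (t / 2)) ≤ C ^ 3 * (2 * ∫ x, tent t z x ∂μ) := by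
      gcongr; linarith
    rw [hL]; linarith
  have hinv : ∀ z : X, dist y z < t → ∀ I : ℝ, 0 ≤ I →
      I / (∫ x, tent t z x ∂μ) ≤ L * (I / v) := by
    intro z hz I hI
    have hW := integral_tent_pos h ht z
    rw [div_le_iff₀ hW, mul_comm L, mul_assoc, div_mul_eq_mul_div, le_div_iff₀ hV]
    exact mul_le_mul_of_nonneg_left (hlow z hz) hI
  have hyy : dist y y < t := by rwa [dist_self]
  set I := ∫ x in ball y (2 * t), |b x - m| ∂μ with hI
  have hI0 : 0 ≤ I := integral_nonneg fun x => abs_nonneg _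
  have hA : ⨍ x in ball y (2 * t), |b x - m| ∂μ = I / v := by
    rw [setAverage_eq, smul_eq_mul, inv_mul_eq_div]
  rw [hA]
  have hIv : 0 ≤ I / v := by positivity
  have h1 : |tentAverage μ t b y' - m| ≤ L * (I / v) :=
    (abs_tentAverage_sub_const_le h ht hb hy m).trans (hinv y' hy I hI0)
  refine ⟨h1.trans ?_, ?_⟩
  · nlinarith [mul_nonneg hL0 hIv]
  · set m' := tentAverage μ t b y'
    have h2 : ∫ x in ball y (2 * t), |b x - m'| ∂μ ≤ I + v * |m' - m| := by
      have h3 : I + v * |m' - m| = ∫ x in ball y (2 * t), (|b x - m| + |m' - m|) ∂μ := by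
        rw [integral_add ((hb.sub (h.locInt_const m)) y _).abs (h.locInt_const _ y _),
          setIntegral_const, smul_eq_mul]
      rw [h3]
      refine integral_mono ((hb.sub (h.locInt_const m')) y _).abs
        (((hb.sub (h.locInt_const m)) y _).abs.add (h.locInt_const _ y _)) fun x => ?_
      have := abs_sub_le (b x) m m'
      rw [abs_sub_comm m m'] at this
      exact this
    have h4 : ∫ x in ball y (2 * t), |b x - m'| ∂μ ≤ (1 + L) * I := by
      have h5 : v * |m' - m| ≤ v * (L * (I / v)) := by gcongr
      have h6 : v * (L * (I / v)) = L * I := by field_simp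
      linarith
    calc |tentAverage μ t b y - m'|
        ≤ dist y y' / t * (∫ x in ball y (2 * t), |b x - m'| ∂μ) / ∫ x, tent t y x ∂μ :=
          abs_tentAverage_sub_le h ht hb hy
      _ ≤ dist y y' / t * ((1 + L) * I / ∫ x, tent t y x ∂μ) := by
          rw [mul_div_assoc]
          have := integral_tent_pos h ht y
          gcongr
      _ ≤ dist y y' / t * (L * ((1 + L) * I / v)) := by
          gcongr
          exact hinv y hyy _ (by positivity)
      _ = _ := by ring

end TentAverage

end FractionalBesov

/-! ### Lipschitz approximation at scale `t` -/

namespace FractionalBesov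

section LipschitzApproximation

variable {X : Type*} [MetricSpace X]

theorem lip_le_of_forall_dist_lt {f : X → ℝ} {y : X} {δ a : ℝ} (hδ : 0 < δ) (ha : 0 ≤ a)
    (h : ∀ x, dist y x < δ → |f y - f x| ≤ a * dist y x) : lip f y ≤ ENNReal.ofReal a := by
  refine liminf_le_of_frequently_le' (Eventually.frequently ?_)
  filter_upwards [Ioo_mem_nhdsGT hδ] with r hr
  refine iSup₂_le fun x hx => ENNReal.ofReal_le_ofReal ?_
  rw [mem_closedBall'] at hx
  have h1 := h x (hx.trans_lt hr.2)
  rw [div_le_iff₀ hr.1]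
  exact h1.trans (mul_le_mul_of_nonneg_left hx ha)

variable [MeasurableSpace X]

/-- The mean of `|b - b(y)|` over the ball `B(y, t)`. -/
noncomputable def meanDist (μ : Measure X) (b : X → ℝ) (t : ℝ) (y : X) : ℝ≥0∞ :=
  ⨍⁻ x in ball y t, ‖b x - b y‖ₑ ∂μ

variable {μ : Measure X}

theorem ofReal_setAverage_abs_sub (h : IsDoubling μ) {b : X → ℝ} (hb : LocInt b μ) (t : ℝ)
    (y : X) : ENNReal.ofReal (⨍ x in ball y t, |b x - b y| ∂μ) = meanDist μ b t y := by
  rw [meanDist, ofReal_setAverage ((hb.sub (h.locInt_const (b y))) y t).abs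
    (ae_of_all _ fun x => abs_nonneg _), setLAverage_eq]
  simp_rw [← Real.norm_eq_abs, ofReal_norm]

variable [BorelSpace X]

/-- The constant is only qualitative: it allows an extension from the ball to a globally Lipschitz
function, as the Poincaré inequality requires. Points closer than `t` use the local estimate, points
further apart the bound on the averages themselves. -/
theorem IsDoubling.exists_lipschitzOnWith_tentAverage (h : IsDoubling μ) {t : ℝ} (ht : 0 < t)
    {b : X → ℝ} (hb : LocInt b μ) (x₀ : X) {R : ℝ} (hR : 0 < R) :
    ∃ K : ℝ≥0, LipschitzOnWith K (tentAverage μ t b) (ball x₀ R) := by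
  obtain ⟨C, hC1, hC⟩ := h.exists_const
  obtain ⟨L, hL0, hL⟩ := h.exists_tentAverage_bound
  have hC0 : 0 < C := zero_lt_one.trans_le hC1
  obtain ⟨n, hn⟩ := pow_unbounded_of_one_lt (R / t) (one_lt_two (α := ℝ))
  rw [div_lt_iff₀ ht] at hn
  set A := ∫ x in ball x₀ (R + 2 * t), |b x| ∂μ
  have hA : 0 ≤ A := integral_nonneg fun x => abs_nonneg _
  have hV := h.measureReal_ball_pos x₀ hR
  set M := A * C ^ n / μ.real (ball x₀ R) with hM
  have hM0 : 0 ≤ M := by positivity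
  have havg : ∀ y ∈ ball x₀ R, ⨍ x in ball y (2 * t), |b x - 0| ∂μ ≤ M := by
    intro y hy
    rw [mem_ball] at hy
    have hVy := h.measureReal_ball_pos y (r := 2 * t) (by positivity)
    have h1 : μ.real (ball x₀ R) ≤ C ^ n * μ.real (ball y (2 * t)) :=
      (h.measureReal_ball_mono (by rw [dist_comm]; linarith)).trans
        (IsDoubling.measureReal_ball_pow_le hC1 hC n y (by positivity))
    have h2 : ∫ x in ball y (2 * t), |b x| ∂μ ≤ A :=
      setIntegral_mono_set (hb x₀ _).abs (ae_of_all _ fun x => abs_nonneg _)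
        (ball_subset_ball' (by linarith)).eventuallyLE
    simp_rw [sub_zero]
    rw [setAverage_eq, smul_eq_mul, inv_mul_eq_div, div_le_div_iff₀ hVy hV]
    calc _ ≤ A * (C ^ n * μ.real (ball y (2 * t))) := by gcongr
      _ = _ := by ring
  refine ⟨⟨2 * (L * M) / t, by positivity⟩, LipschitzOnWith.of_dist_le_mul fun y hy y' hy' => ?_⟩
  rw [Real.dist_eq]
  change _ ≤ 2 * (L * M) / t * dist y y'
  have hLM : L * ⨍ x in ball y (2 * t), |b x - 0| ∂μ ≤ L * M :=
    mul_le_mul_of_nonneg_left (havg y hy) hL0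
  have hLM' : L * ⨍ x in ball y' (2 * t), |b x - 0| ∂μ ≤ L * M :=
    mul_le_mul_of_nonneg_left (havg y' hy') hL0
  have hd : 0 ≤ dist y y' / t := by positivity
  have hLM0 : 0 ≤ L * M := by positivity
  have hrw : 2 * (L * M) / t * dist y y' = 2 * (dist y y' / t * (L * M)) := by ring
  rw [hrw]
  rcases lt_or_ge (dist y y') t with hyy | hyy
  · have h1 := (hL t ht b hb y y' hyy 0).2
    have h2 := mul_le_mul_of_nonneg_left hLM hd
    have h3 := mul_nonneg hd hLM0
    linarith
  · have h1 := (hL t ht b hb y y (by rwa [dist_self]) 0).1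
    have h2 := (hL t ht b hb y' y' (by rwa [dist_self]) 0).1
    have h3 : 1 ≤ dist y y' / t := (one_le_div ht).2 hyy
    have h4 := abs_sub (tentAverage μ t b y) (tentAverage μ t b y')
    rw [sub_zero] at h1 h2
    nlinarith

/-- A locally integrable function on a doubling space is approximated by Lipschitz functions at
every scale `t`. -/
theorem IsDoubling.exists_lipschitz_approx (h : IsDoubling μ) :
    ∃ L : ℝ≥0, ∀ t : ℝ, 0 < t → ∀ b : X → ℝ, LocInt b μ → ∀ (x₀ : X) (R : ℝ), 0 < R →
      ∃ f : X → ℝ, (∃ K, LipschitzWith K f) ∧ ∀ y ∈ ball x₀ R,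
        ‖f y - b y‖ₑ ≤ L * meanDist μ b (2 * t) y ∧
        lip f y ≤ L * (meanDist μ b (2 * t) y / ENNReal.ofReal t) := by
  obtain ⟨L, hL0, hL⟩ := h.exists_tentAverage_bound
  refine ⟨NNReal.mk L hL0, fun t ht b hb x₀ R hR => ?_⟩
  obtain ⟨K, hK⟩ := h.exists_lipschitzOnWith_tentAverage ht hb x₀ hR
  obtain ⟨f, hf, hfeq⟩ := hK.extend_real
  refine ⟨f, ⟨K, hf⟩, fun y hy => ?_⟩
  have hcoe : ((NNReal.mk L hL0 : ℝ≥0) : ℝ≥0∞) = ENNReal.ofReal L :=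
    (ENNReal.ofReal_eq_coe_nnreal hL0).symm
  rw [hcoe, ← ofReal_setAverage_abs_sub h hb]
  constructor
  · rw [← hfeq hy, ← ENNReal.ofReal_mul hL0, ← ofReal_norm]
    exact ENNReal.ofReal_le_ofReal (hL t ht b hb y y (by rwa [dist_self]) (b y)).1
  · rw [← ENNReal.ofReal_div_of_pos ht, ← ENNReal.ofReal_mul hL0]
    have hI : 0 ≤ ⨍ x in ball y (2 * t), |b x - b y| ∂μ :=
      integral_nonneg fun x => abs_nonneg _
    -- Within `t` the local estimate applies; within `R - dist y x₀` the extension still agrees with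
    -- the tent average.
    have hδ : 0 < min t (R - dist y x₀) := lt_min ht (sub_pos.2 hy)
    refine lip_le_of_forall_dist_lt hδ (by positivity) fun x hx => ?_
    have hx1 := hx.trans_le (min_le_left _ _)
    have hx2 := hx.trans_le (min_le_right _ _)
    have hxS : x ∈ ball x₀ R := by
      rw [mem_ball]
      have := dist_triangle x y x₀
      rw [dist_comm x y] at this
      linarith
    rw [← hfeq hy, ← hfeq hxS]
    refine (hL t ht b hb y x hx1 (b y)).2.trans_eq ?_
    ring

end LipschitzApproximation

end FractionalBesov

/-! ### Vanishing oscillation through the Poincaré inequality -/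

namespace FractionalBesov

section Constancy

theorem laverage_rpow_le {Y : Type*} [MeasurableSpace Y] {μ : Measure Y} [IsFiniteMeasure μ]
    [NeZero μ] {f : Y → ℝ≥0∞} (hf : AEMeasurable f μ) {p : ℝ} (hp : 1 ≤ p) :
    (⨍⁻ x, f x ∂μ) ^ p ≤ ⨍⁻ x, f x ^ p ∂μ := by
  have hp0 : 0 < p := by linarith
  have h := eLpNorm'_le_eLpNorm'_of_exponent_le zero_lt_one hp ((μ Set.univ)⁻¹ • μ)
    (hf.aestronglyMeasurable.smul_measure _)
  simp only [eLpNorm', enorm_eq_self, ENNReal.rpow_one, div_one] at h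
  rwa [one_div, ENNReal.le_rpow_inv_iff hp0] at h

/-- The mean oscillation is stable under approximation in mean. -/
theorem ofReal_meanOscillation_le {Y : Type*} [MeasurableSpace Y] {P : Measure Y}
    [IsProbabilityMeasure P] {b f : Y → ℝ} (hb : Integrable b P) (hf : Integrable f P) :
    ENNReal.ofReal (∫ y, |b y - ∫ z, b z ∂P| ∂P) ≤
      ENNReal.ofReal (∫ y, |f y - ∫ z, f z ∂P| ∂P) + 2 * ∫⁻ y, ‖f y - b y‖ₑ ∂P := by
  have hfb : Integrable (fun y => |f y - b y|) P := (hf.sub hb).abs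
  have hff : Integrable (fun y => |f y - ∫ z, f z ∂P|) P := (hf.sub (integrable_const _)).abs
  have hbb : Integrable (fun y => |b y - ∫ z, b z ∂P|) P := (hb.sub (integrable_const _)).abs
  have h1 : |(∫ z, f z ∂P) - ∫ z, b z ∂P| ≤ ∫ y, |f y - b y| ∂P := by
    rw [← integral_sub hf hb]
    exact abs_integral_le_integral_abs
  have h2 : ∫ y, |b y - ∫ z, b z ∂P| ∂P ≤
      (∫ y, |f y - ∫ z, f z ∂P| ∂P) + 2 * ∫ y, |f y - b y| ∂P := by
    calc ∫ y, |b y - ∫ z, b z ∂P| ∂P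
        ≤ ∫ y, (|f y - b y| + |f y - ∫ z, f z ∂P| + ∫ y, |f y - b y| ∂P) ∂P := by
          refine integral_mono hbb ((hfb.add hff).add (integrable_const _)) fun y => ?_
          have h3 := abs_sub_le (b y) (f y) (∫ z, b z ∂P)
          have h4 := abs_sub_le (f y) (∫ z, f z ∂P) (∫ z, b z ∂P)
          rw [abs_sub_comm (b y) (f y)] at h3
          dsimp only
          linarith
      _ = _ := by
          have h3 := integral_add (hfb.add hff) (integrable_const (∫ y, |f y - b y| ∂P))
          have h4 := integral_add hfb hff
          simp only [Pi.add_apply] at h3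
          rw [h3, h4]
          simp only [integral_const, probReal_univ, one_smul]
          ring
  have h5 : ∫⁻ y, ‖f y - b y‖ₑ ∂P = ENNReal.ofReal (∫ y, |f y - b y| ∂P) := by
    rw [ofReal_integral_eq_lintegral_ofReal hfb (ae_of_all _ fun y => abs_nonneg _)]
    simp_rw [← Real.norm_eq_abs, ofReal_norm]
  rw [h5, ← ENNReal.ofReal_ofNat 2, ← ENNReal.ofReal_mul zero_le_two, ← ENNReal.ofReal_add
    (integral_nonneg fun y => abs_nonneg _)
    (mul_nonneg zero_le_two (integral_nonneg fun y => abs_nonneg _))]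
  exact ENNReal.ofReal_le_ofReal h2

variable {X : Type*} [MetricSpace X] [MeasurableSpace X] {μ : Measure X}

/-- The constants on concentric balls agree because the smallest ball has positive measure; the
radii `n + 1` keep that ball nonempty. -/
theorem IsDoubling.exists_ae_eq_const (h : IsDoubling μ) {b : X → ℝ}
    (hb : ∀ (x₀ : X) (R : ℝ), 0 < R → ∃ c : ℝ, ∀ᵐ y ∂μ.restrict (ball x₀ R), b y = c) :
    ∃ c : ℝ, b =ᵐ[μ] fun _ => c := by
  rcases isEmpty_or_nonempty X with hX | ⟨⟨x₀⟩⟩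
  · exact ⟨0, ae_of_all _ fun x => isEmptyElim x⟩
  choose c hc using fun n : ℕ => hb x₀ (n + 1) (by positivity)
  have hne : ∀ n : ℕ, c n = c 0 := by
    intro n
    have hsub : ball x₀ ((0 : ℕ) + 1 : ℝ) ⊆ ball x₀ (n + 1) :=
      ball_subset_ball (by simp)
    have h1 := ae_restrict_of_ae_restrict_of_subset hsub (hc n)
    have hne : (ae (μ.restrict (ball x₀ ((0 : ℕ) + 1 : ℝ)))).NeBot := by
      rw [ae_neBot, Ne, Measure.restrict_eq_zero]
      exact (h.measure_ball_pos x₀ (by simp)).ne'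
    obtain ⟨y, h2, h3⟩ := (h1.and (hc 0)).exists
    exact h2.symm.trans h3
  refine ⟨c 0, ?_⟩
  have hun : ⋃ n : ℕ, ball x₀ (n + 1 : ℝ) = Set.univ := by
    refine Set.eq_univ_of_forall fun x => ?_
    obtain ⟨n, hn⟩ := exists_nat_gt (dist x x₀)
    exact Set.mem_iUnion.2 ⟨n, by rw [mem_ball]; linarith⟩
  rw [EventuallyEq, ← Measure.restrict_univ (μ := μ), ← hun, ae_restrict_iUnion_iff]
  intro n
  filter_upwards [hc n] with y hy
  rw [hy, hne n]

variable [BorelSpace X]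

/-- After Jensen, `ρ ≤ t` and `μ(B(y,ρ)) ≤ μ(B(y,t))` in the hypothesis produce the factor `t^p
μ(B(y,t))`, which cancels the scaling and the normalization of the average. -/
theorem IsDoubling.meanDist_div_rpow_le (h : IsDoubling μ) {b : X → ℝ} (hb : LocInt b μ) {p : ℝ}
    (hp : 1 ≤ p) {t : ℝ} (ht : 0 < t) {y : X} {A : ℝ≥0} {g : X → ℝ≥0∞}
    (hg : ∀ x ∈ ball y t, x ≠ y → ‖b x - b y‖ₑ ^ p ≤
      A * (g x * (ENNReal.ofReal (dist x y) ^ p * μ (ball y (dist x y))))) :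
    (meanDist μ b t y / ENNReal.ofReal t) ^ p ≤ A * ∫⁻ x in ball y t, g x ∂μ := by
  have hp0 : 0 < p := by linarith
  have hV0 := (h.measure_ball_pos y ht).ne'
  have hV := (h.measure_ball_lt_top y t).ne
  have hfin : IsFiniteMeasure (μ.restrict (ball y t)) := ⟨by simpa using hV.lt_top⟩
  have hne : NeZero (μ.restrict (ball y t)) := ⟨by
    rwa [Ne, Measure.restrict_eq_zero]⟩
  have ht0 : ENNReal.ofReal t ^ p ≠ 0 := (ENNReal.rpow_pos (by simpa) (by simp)).ne'
  have htt : ENNReal.ofReal t ^ p ≠ ∞ := ENNReal.rpow_ne_top_of_nonneg hp0.le (by simp)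
  have h1 : meanDist μ b t y ^ p ≤ ⨍⁻ x in ball y t, ‖b x - b y‖ₑ ^ p ∂μ :=
    laverage_rpow_le ((hb.sub (h.locInt_const (b y))) y t).aestronglyMeasurable.enorm hp
  rw [ENNReal.div_rpow_of_nonneg _ _ hp0.le, ENNReal.div_le_iff ht0 htt]
  refine h1.trans ?_
  rw [setLAverage_eq, ENNReal.div_le_iff hV0 hV]
  have hc : A * (ENNReal.ofReal t ^ p * μ (ball y t)) ≠ ∞ :=
    ENNReal.mul_ne_top ENNReal.coe_ne_top (ENNReal.mul_ne_top htt hV)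
  calc ∫⁻ x in ball y t, ‖b x - b y‖ₑ ^ p ∂μ
      ≤ ∫⁻ x in ball y t, A * (ENNReal.ofReal t ^ p * μ (ball y t)) * g x ∂μ := by
        refine setLIntegral_mono' measurableSet_ball fun x hx => ?_
        rcases eq_or_ne x y with rfl | hxy
        · simp [hp0]
        · refine (hg x hx hxy).trans ?_
          rw [mem_ball] at hx
          rw [mul_assoc, mul_comm (g x)]
          gcongr
    _ = _ := by
        rw [lintegral_const_mul' _ _ hc]
        ring

/-- Scaled mean oscillations vanish in the limit when they are dominated by a locally integrable
kernel. -/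
theorem IsDoubling.tendsto_lintegral_meanDist (h : IsDoubling μ) {b : X → ℝ} (hb : LocInt b μ)
    {p : ℝ} (hp : 1 ≤ p) {g : X × X → ℝ≥0∞} (hg0 : ∀ x, g (x, x) = 0) {x₀ : X} {R : ℝ}
    (hgm : AEMeasurable g ((μ.prod μ).restrict (ball x₀ (R + 1) ×ˢ ball x₀ (R + 1))))
    (hgi : ∫⁻ z in ball x₀ (R + 1) ×ˢ ball x₀ (R + 1), g z ∂(μ.prod μ) ≠ ∞) {A : ℝ≥0}
    (hA : ∀ y ∈ ball x₀ (R + 1), ∀ x ∈ ball x₀ (R + 1), x ≠ y → ‖b x - b y‖ₑ ^ p ≤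
      A * (g (y, x) * (ENNReal.ofReal (dist x y) ^ p * μ (ball y (dist x y)))))
    {t : ℕ → ℝ} (ht0 : ∀ n, 0 < t n) (ht1 : ∀ n, t n ≤ 1) (ht : Tendsto t atTop (𝓝 0)) :
    Tendsto (fun n => ∫⁻ y in ball x₀ R, (meanDist μ b (t n) y / ENNReal.ofReal (t n)) ^ p ∂μ)
      atTop (𝓝 0) := by
  have := h.secondCountableTopology
  have := h.sigmaFinite
  set B := ball x₀ (R + 1) with hB
  have hBm : MeasurableSet B := measurableSet_ball
  set E : ℕ → Set (X × X) := fun n => {z | dist z.2 z.1 < t n} with hE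
  have hEm : ∀ n, MeasurableSet (E n) := fun n =>
    measurableSet_lt (measurable_snd.dist measurable_fst) measurable_const
  have hlim : Tendsto (fun n => ∫⁻ z in B ×ˢ B, (E n).indicator g z ∂(μ.prod μ)) atTop
      (𝓝 (∫⁻ _ in B ×ˢ B, 0 ∂(μ.prod μ))) := by
    -- Off the diagonal the strips `E n` eventually miss `z`. On it `g` must vanish: under doubling
    -- alone, atoms may give the diagonal positive measure.
    refine tendsto_lintegral_of_dominated_convergence' g (fun n => hgm.indicator (hEm n))
      (fun n => ae_of_all _ fun z => Set.indicator_le_self _ _ z) hgi (ae_of_all _ fun z => ?_)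
    rcases eq_or_ne z.2 z.1 with hz | hz
    · have : g z = 0 := by
        have := hg0 z.1
        rwa [show (z.1, z.1) = z from Prod.ext rfl hz.symm] at this
      have h0 : ∀ n, (E n).indicator g z = 0 := fun n => by
        by_cases hzn : z ∈ E n <;> simp [hzn, this]
      simp_rw [h0]
      exact tendsto_const_nhds
    · refine tendsto_const_nhds.congr' ?_
      filter_upwards [ht.eventually_lt_const (dist_pos.2 hz)] with n hn
      exact (Set.indicator_of_notMem (show z ∉ E n from lt_asymm hn) g).symm
  rw [lintegral_zero] at hlim
  have hlim' := ENNReal.Tendsto.const_mul (a := A) hlim (Or.inr ENNReal.coe_ne_top)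
  rw [mul_zero] at hlim'
  refine tendsto_of_tendsto_of_tendsto_of_le_of_le tendsto_const_nhds hlim'
    (fun n => zero_le) fun n => ?_
  have hprod : ∫⁻ z in B ×ˢ B, (E n).indicator g z ∂(μ.prod μ) =
      ∫⁻ y in B, ∫⁻ x in B, (E n).indicator g (y, x) ∂μ ∂μ := by
    rw [← Measure.prod_restrict] at hgm ⊢
    exact lintegral_prod _ (hgm.indicator (hEm n))
  dsimp only
  rw [hprod, ← lintegral_const_mul' _ _ ENNReal.coe_ne_top]
  calc ∫⁻ y in ball x₀ R, (meanDist μ b (t n) y / ENNReal.ofReal (t n)) ^ p ∂μ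
      ≤ ∫⁻ y in ball x₀ R, A * ∫⁻ x in B, (E n).indicator g (y, x) ∂μ ∂μ := by
        refine setLIntegral_mono' measurableSet_ball fun y hy => ?_
        have hsub : ball y (t n) ⊆ B := ball_subset_ball' (by
          rw [mem_ball] at hy; linarith [ht1 n])
        have hyB : y ∈ B := hsub (mem_ball_self (ht0 n))
        refine (h.meanDist_div_rpow_le hb hp (ht0 n) (g := fun x => g (y, x))
          fun x hx hxy => hA y hyB x (hsub hx) hxy).trans ?_
        gcongr A * ?_
        calc ∫⁻ x in ball y (t n), g (y, x) ∂μ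
            = ∫⁻ x in ball y (t n), (E n).indicator g (y, x) ∂μ :=
              setLIntegral_congr_fun measurableSet_ball fun x hx =>
                (Set.indicator_of_mem (show (y, x) ∈ E n from hx) g).symm
          _ ≤ _ := lintegral_mono_set hsub
    _ ≤ _ := lintegral_mono_set (ball_subset_ball (by linarith))

theorem HasPoincare.ae_eq_average_of_tendsto (h : IsDoubling μ) {p : ℝ} (hp : 1 ≤ p)
    (hP : HasPoincare μ p) {b : X → ℝ} (hb : LocInt b μ)
    {t : ℕ → ℝ} (ht0 : ∀ n, 0 < t n) (ht : Tendsto t atTop (𝓝 0))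
    (hlim : ∀ (x₀ : X) (R : ℝ), Tendsto (fun n =>
      ∫⁻ y in ball x₀ R, (meanDist μ b (t n) y / ENNReal.ofReal (t n)) ^ p ∂μ) atTop (𝓝 0))
    (x₀ : X) {R : ℝ} (hR : 0 < R) :
    ∀ᵐ y ∂μ.restrict (ball x₀ R), b y = ⨍ z in ball x₀ R, b z ∂μ := by
  have hp0 : 0 < p := by linarith
  obtain ⟨lam, c, hlam, hP⟩ := hP
  obtain ⟨L, hL⟩ := h.exists_lipschitz_approx
  set B := ball x₀ R with hB
  have hlR : 0 < lam * R := by positivity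
  have hBsub : B ⊆ ball x₀ (lam * R) := ball_subset_ball (by nlinarith)
  have hVB0 : μ B ≠ 0 := (h.measure_ball_pos x₀ hR).ne'
  have hVB : μ B ≠ ∞ := (h.measure_ball_lt_top x₀ R).ne
  have hV0 := (h.measure_ball_pos x₀ hlR).ne'
  have hfin : IsFiniteMeasure (μ.restrict B) := ⟨by simpa using hVB.lt_top⟩
  have hne : NeZero (μ.restrict B) := ⟨by rwa [Ne, Measure.restrict_eq_zero]⟩
  set J : ℕ → ℝ≥0∞ := fun n =>
    ∫⁻ y in ball x₀ (lam * R), (meanDist μ b (t n) y / ENNReal.ofReal (t n)) ^ p ∂μ with hJ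
  have hJ0 : Tendsto J atTop (𝓝 0) := hlim x₀ (lam * R)
  have hkey : ∀ n, ENNReal.ofReal (⨍ y in B, |b y - ⨍ z in B, b z ∂μ| ∂μ) ≤
      c * ENNReal.ofReal R * ((2 * L) ^ p * J n / μ (ball x₀ (lam * R))) ^ (1 / p) +
        2 * ((μ B)⁻¹ * (L * (ENNReal.ofReal (t n) * (μ B + J n)))) := by
    intro n
    have htn := ht0 n
    have htn0 : ENNReal.ofReal (t n) ≠ 0 := by simpa using htn
    -- Approximation at scale `t n / 2` involves means over balls of radius `t n`; the halving is
    -- the source of the `2` in `(2 * L) ^ p`.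
    obtain ⟨f, hf, hfb⟩ := hL (t n / 2) (half_pos htn) b hb x₀ (lam * R) hlR
    rw [mul_div_cancel₀ _ two_ne_zero] at hfb
    have hpoin := hP f hf x₀ R hR
    obtain ⟨K, hK⟩ := hf
    have hfi : IntegrableOn f B μ := by
      have hbd : ∀ y ∈ B, ‖f y‖ ≤ ‖f x₀‖ + K * R := by
        intro y hy
        have h1 := hK.dist_le_mul y x₀
        rw [dist_eq_norm] at h1
        have h2 := norm_sub_norm_le (f y) (f x₀)
        have h3 : (K : ℝ) * dist y x₀ ≤ K * R :=
          mul_le_mul_of_nonneg_left (le_of_lt hy) K.2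
        linarith
      exact Measure.integrableOn_of_bounded hVB hK.continuous.measurable.aestronglyMeasurable
        ((ae_restrict_iff' measurableSet_ball).2 (ae_of_all _ hbd))
    have hosc := ofReal_meanOscillation_le
      (P := (μ.restrict B Set.univ)⁻¹ • μ.restrict B)
      ((hb x₀ R).smul_measure (by simpa using hVB0))
      (hfi.smul_measure (by simpa using hVB0))
    refine hosc.trans (add_le_add (hpoin.trans ?_) ?_)
    · gcongr
      rw [setLAverage_eq]
      gcongr
      rw [hJ, ← lintegral_const_mul' _ _ (ENNReal.rpow_ne_top_of_nonneg hp0.le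
        (ENNReal.mul_ne_top (by simp) ENNReal.coe_ne_top))]
      refine setLIntegral_mono' measurableSet_ball fun y hy => ?_
      rw [← ENNReal.mul_rpow_of_nonneg _ _ hp0.le]
      refine ENNReal.rpow_le_rpow ((hfb y hy).2.trans_eq ?_) hp0.le
      rw [ENNReal.ofReal_div_of_pos two_pos, ENNReal.ofReal_ofNat, div_eq_mul_inv,
        div_eq_mul_inv, div_eq_mul_inv, ENNReal.mul_inv (Or.inl htn0) (Or.inl (by simp)), inv_inv]
      ring
    · rw [lintegral_smul_measure, Measure.restrict_apply_univ, smul_eq_mul]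
      gcongr
      calc ∫⁻ y in B, ‖f y - b y‖ₑ ∂μ
          ≤ ∫⁻ y in B, L * (ENNReal.ofReal (t n) *
              (1 + (meanDist μ b (t n) y / ENNReal.ofReal (t n)) ^ p)) ∂μ := by
            refine setLIntegral_mono' measurableSet_ball fun y hy => ?_
            refine (hfb y (hBsub hy)).1.trans ?_
            gcongr
            set s := meanDist μ b (t n) y / ENNReal.ofReal (t n) with hs
            have h1 : meanDist μ b (t n) y = ENNReal.ofReal (t n) * s :=
              (ENNReal.mul_div_cancel htn0 (by simp)).symm
            -- This crude bound replaces Hölder: the error keeps a factor `t n`, so boundedness of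
            -- the `p`-th moments is enough.
            have h2 : s ≤ 1 + s ^ p := by
              rcases le_total s 1 with hs1 | hs1
              · exact hs1.trans le_self_add
              · exact (ENNReal.le_rpow_self_of_one_le hs1 hp).trans le_add_self
            rw [h1]
            gcongr
        _ = L * (ENNReal.ofReal (t n) * (μ B + ∫⁻ y in B,
              (meanDist μ b (t n) y / ENNReal.ofReal (t n)) ^ p ∂μ)) := by
            rw [lintegral_const_mul' _ _ ENNReal.coe_ne_top,
              lintegral_const_mul' _ _ ENNReal.ofReal_ne_top,
              lintegral_add_left measurable_const, setLIntegral_one]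
        _ ≤ _ := by
            gcongr
            exact lintegral_mono_set hBsub
  have hzero : Tendsto (fun n =>
      c * ENNReal.ofReal R * ((2 * L) ^ p * J n / μ (ball x₀ (lam * R))) ^ (1 / p) +
        2 * ((μ B)⁻¹ * (L * (ENNReal.ofReal (t n) * (μ B + J n))))) atTop (𝓝 0) := by
    have h2L : ((2 * L : ℝ≥0∞)) ^ p ≠ ∞ := ENNReal.rpow_ne_top_of_nonneg hp0.le
      (ENNReal.mul_ne_top (by simp) ENNReal.coe_ne_top)
    have h1 : Tendsto (fun n => (2 * L : ℝ≥0∞) ^ p * J n / μ (ball x₀ (lam * R))) atTop (𝓝 0) := by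
      have := ENNReal.Tendsto.div_const (ENNReal.Tendsto.const_mul (a := (2 * L : ℝ≥0∞) ^ p) hJ0
        (Or.inr h2L)) (b := μ (ball x₀ (lam * R))) (Or.inr hV0)
      simpa using this
    have h2 := (ENNReal.continuous_rpow_const (y := 1 / p)).tendsto 0 |>.comp h1
    rw [ENNReal.zero_rpow_of_pos (by positivity)] at h2
    have h3 := ENNReal.Tendsto.const_mul (a := c * ENNReal.ofReal R) h2
      (Or.inr (ENNReal.mul_ne_top ENNReal.coe_ne_top ENNReal.ofReal_ne_top))
    have h4 : Tendsto (fun n => ENNReal.ofReal (t n)) atTop (𝓝 0) := by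
      simpa using ENNReal.tendsto_ofReal ht
    have h5 : Tendsto (fun n => ENNReal.ofReal (t n) * (μ B + J n)) atTop (𝓝 0) := by
      have := ENNReal.Tendsto.mul h4 (Or.inr (by simpa using hVB))
        (tendsto_const_nhds.add hJ0 : Tendsto (fun n => μ B + J n) atTop (𝓝 (μ B + 0)))
        (Or.inr (by simp))
      simpa using this
    have h6 := ENNReal.Tendsto.const_mul (a := (2 : ℝ≥0∞)) (ENNReal.Tendsto.const_mul
      (a := (μ B)⁻¹) (ENNReal.Tendsto.const_mul (a := (L : ℝ≥0∞)) h5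
        (Or.inr ENNReal.coe_ne_top)) (Or.inr (by simpa using hVB0))) (Or.inr (by simp))
    simpa using h3.add h6
  have hle : ENNReal.ofReal (⨍ y in B, |b y - ⨍ z in B, b z ∂μ| ∂μ) ≤ 0 :=
    ge_of_tendsto' hzero hkey
  have hbint : Integrable (fun y => |b y - ⨍ z in B, b z ∂μ|) (μ.restrict B) :=
    ((hb.sub (h.locInt_const _)) x₀ R).abs
  have hav : ⨍ y in B, |b y - ⨍ z in B, b z ∂μ| ∂μ ≤ 0 := by simpa using hle
  rw [setAverage_eq, smul_eq_mul] at hav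
  have hreal : 0 < (μ.real B)⁻¹ := inv_pos.2 (h.measureReal_ball_pos x₀ hR)
  have hint0 : ∫ y in B, |b y - ⨍ z in B, b z ∂μ| ∂μ = 0 :=
    le_antisymm (nonpos_of_mul_nonpos_right hav hreal) (integral_nonneg fun y => abs_nonneg _)
  rw [integral_eq_zero_iff_of_nonneg (fun y => abs_nonneg _) hbint] at hint0
  filter_upwards [hint0] with y hy
  exact sub_eq_zero.1 (abs_eq_zero.1 hy)

end Constancy

end FractionalBesov

/-! ### The kernel and the function spaces -/

namespace FractionalBesov

section Kernel

variable {X : Type*} [MetricSpace X] [MeasurableSpace X] {μ : Measure X}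

/-- The lower dimension is read downwards from the fixed scale `2 * R`, where volumes are uniformly
bounded by that of `B(x₀,3R)`. Distances inside `B(x₀,R)` stay below `2 * R`. -/
theorem IsDoubling.measureReal_ball_le_rpow (h : IsDoubling μ) {d : ℝ}
    (hdim : HasLowerDim μ d) (x₀ : X) (R : ℝ) :
    ∃ a : ℝ, 0 < a ∧ ∀ x ∈ ball x₀ R, ∀ r : ℝ, 0 < r → r ≤ 2 * R →
      μ.real (ball x r) ≤ a * r ^ d := by
  rcases le_or_gt R 0 with hR | hR
  · exact ⟨1, one_pos, fun x hx => by simp [ball_eq_empty.2 hR] at hx⟩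
  obtain ⟨c, hc, hdim⟩ := hdim
  have hV := h.measureReal_ball_pos x₀ (r := 3 * R) (by positivity)
  refine ⟨μ.real (ball x₀ (3 * R)) / (c * (2 * R) ^ d), by positivity, fun x hx r hr hrR => ?_⟩
  rw [mem_ball] at hx
  have h1 := hdim x r (2 * R) hr hrR
  have h2 : μ.real (ball x (2 * R)) ≤ μ.real (ball x₀ (3 * R)) :=
    h.measureReal_ball_mono (by linarith)
  rw [le_div_iff₀ (h.measureReal_ball_pos x hr), Real.div_rpow (by positivity) hr.le] at h1
  have hrd : 0 < r ^ d := by positivity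
  rw [div_mul_eq_mul_div, le_div_iff₀ (by positivity)]
  have h3 : c * ((2 * R) ^ d / r ^ d) * μ.real (ball x r) * r ^ d =
      μ.real (ball x r) * (c * (2 * R) ^ d) := by field_simp
  rw [← h3]
  exact mul_le_mul_of_nonneg_right (h1.trans h2) hrd.le

theorem V_nonneg (x y : X) : 0 ≤ V μ x y := by
  unfold V; split_ifs <;> exact measureReal_nonneg

theorem V_of_ne {x y : X} (hxy : x ≠ y) : V μ x y = μ.real (ball x (dist x y)) := if_neg hxy

theorem IsDoubling.V_pos (h : IsDoubling μ) {x y : X} (hxy : x ≠ y) : 0 < V μ x y := by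
  rw [V_of_ne hxy]
  exact h.measureReal_ball_pos x (dist_pos.2 hxy)

theorem phiVol_nonneg (ε : ℝ) (x y : X) : 0 ≤ phiVol μ ε x y := Real.rpow_nonneg (V_nonneg x y) _

omit [MeasurableSpace X] in
theorem phiMet_nonneg (α : ℝ) (x y : X) : 0 ≤ phiMet α x y := Real.rpow_nonneg dist_nonneg _

/-- Locally, the volume is dominated by `(φ ρ)^p` for both choices of `φ`. -/
theorem IsDoubling.exists_V_le (h : IsDoubling μ) {d ε α p : ℝ} (hd : 1 ≤ d) (hε : 0 ≤ ε)
    (hα : α = ε * d) (hp : p = d / (1 + ε * d)) (hdim : HasLowerDim μ d) {φ : X → X → ℝ}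
    (hφ : φ = phiVol μ ε ∨ φ = phiMet α) (x₀ : X) (R : ℝ) :
    ∃ A : ℝ, 0 ≤ A ∧ ∀ y ∈ ball x₀ R, ∀ x ∈ ball x₀ R, x ≠ y →
      V μ y x ≤ A * φ y x ^ p * dist x y ^ p := by
  obtain ⟨a, ha, hle⟩ := h.measureReal_ball_le_rpow hdim x₀ R
  have hd0 : 0 < d := by linarith
  have hεd : 0 < 1 + ε * d := by positivity
  have hp0 : 0 < p := by rw [hp]; positivity
  have hle' : ∀ y ∈ ball x₀ R, ∀ x ∈ ball x₀ R, x ≠ y → V μ y x ≤ a * dist x y ^ d := by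
    intro y hy x hx hxy
    rw [V_of_ne hxy.symm, dist_comm y x]
    refine hle y hy _ (dist_pos.2 hxy) ?_
    have := dist_triangle_right x y x₀
    rw [mem_ball] at hx hy
    linarith
  -- In the volumic case `ε p + p/d = 1`: the power `V^(εp)` is `φ^p`, and only `V^(p/d)` is
  -- estimated by `ρ^p`. In the metric case `α p + p = d`, so `ρ^d = (φ ρ)^p`.
  rcases hφ with rfl | rfl
  · refine ⟨a ^ (p / d), by positivity, fun y hy x hx hxy => ?_⟩
    have hv := h.V_pos hxy.symm
    have hρ := dist_pos.2 hxy
    have h1 : ε * p + p / d = 1 := by rw [hp]; field_simp; ring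
    calc V μ y x = V μ y x ^ (ε * p) * V μ y x ^ (p / d) := by
          rw [← Real.rpow_add hv, h1, Real.rpow_one]
      _ ≤ V μ y x ^ (ε * p) * (a * dist x y ^ d) ^ (p / d) := by
          gcongr
          exact hle' y hy x hx hxy
      _ = a ^ (p / d) * phiVol μ ε y x ^ p * dist x y ^ p := by
          rw [Real.mul_rpow ha.le (by positivity), ← Real.rpow_mul hρ.le,
            mul_div_cancel₀ _ hd0.ne', phiVol, ← Real.rpow_mul hv.le]
          ring
  · refine ⟨a, ha.le, fun y hy x hx hxy => (hle' y hy x hx hxy).trans_eq ?_⟩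
    have hρ := dist_pos.2 hxy
    have h1 : α * p + p = d := by rw [hp, hα]; field_simp; ring
    rw [phiMet, dist_comm y x, ← Real.rpow_mul hρ.le, mul_assoc, ← Real.rpow_add hρ, h1]

variable [BorelSpace X]

/-- Both volumes are measures of sections of measurable sets in a product. -/
theorem measurable_V [SecondCountableTopology X] [SFinite μ] :
    Measurable fun z : X × X => V μ z.1 z.2 := by
  unfold V
  refine Measurable.ite (measurableSet_eq_fun measurable_fst measurable_snd) ?_ ?_
  · have h1 : Measurable fun x : X => μ (Prod.mk x ⁻¹' {w : X × X | w.2 = w.1}) :=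
      measurable_measure_prodMk_left (measurableSet_eq_fun measurable_snd measurable_fst)
    exact h1.ennreal_toReal.comp measurable_fst
  · have h1 : Measurable fun z : X × X =>
        μ (Prod.mk z ⁻¹' {w : (X × X) × X | dist w.2 w.1.1 < dist w.1.1 w.1.2}) :=
      measurable_measure_prodMk_left (measurableSet_lt (by fun_prop) (by fun_prop))
    exact h1.ennreal_toReal

omit [BorelSpace X] in
theorem LocInt.aestronglyMeasurable {E : Type*} [NormedAddCommGroup E] {b : X → E}
    (hb : LocInt b μ) : AEStronglyMeasurable b μ := by
  rcases isEmpty_or_nonempty X with hX | ⟨⟨x₀⟩⟩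
  · rw [Measure.eq_zero_of_isEmpty μ]
    exact aestronglyMeasurable_zero_measure b
  · rw [← Measure.restrict_univ (μ := μ), ← iUnion_ball_nat x₀, aestronglyMeasurable_iUnion_iff]
    exact fun n => (hb x₀ n).aestronglyMeasurable

theorem IsDoubling.locInt_kernel (h : IsDoubling μ) {p : ℝ} (hp : 0 < p) {φ : X → X → ℝ}
    (hφ : ∀ x y, 0 ≤ φ x y) (hφm : Measurable fun z : X × X => φ z.1 z.2) {b : X → ℂ}
    (hb : LocInt b μ) (hnorm : normB μ p φ b < ∞) :
    LocInt (fun z : X × X => ‖b z.1 - b z.2‖ ^ p / V μ z.1 z.2 ^ 2 * φ z.1 z.2 ^ p)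
      (μ.prod μ) := by
  have := h.secondCountableTopology
  have := h.sigmaFinite
  have hbm := hb.aestronglyMeasurable
  have hm : AEMeasurable
      (fun z : X × X => ‖b z.1 - b z.2‖ ^ p / V μ z.1 z.2 ^ 2 * φ z.1 z.2 ^ p) (μ.prod μ) :=
    (((hbm.comp_fst.sub hbm.comp_snd).norm.aemeasurable.pow_const p).div
      (measurable_V.pow_const 2).aemeasurable).mul (hφm.pow_const p).aemeasurable
  rw [normB, ENNReal.rpow_lt_top_iff_of_pos (by positivity)] at hnorm
  have hint : Integrable
      (fun z : X × X => ‖b z.1 - b z.2‖ ^ p / V μ z.1 z.2 ^ 2 * φ z.1 z.2 ^ p) (μ.prod μ) := by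
    refine ⟨hm.aestronglyMeasurable, ?_⟩
    rw [hasFiniteIntegral_iff_ofReal (ae_of_all _ fun z => by
      have := hφ z.1 z.2
      change (0 : ℝ) ≤ _
      positivity), lintegral_prod_symm _ hm.ennreal_ofReal]
    exact hnorm
  exact fun x r => hint.integrableOn

/-- Here `b'` is meant to be the real or imaginary part of `b`: the Poincaré inequality concerns
real functions, while the kernel of `b` dominates that of either part. -/
theorem IsDoubling.ae_const_of_kernel (h : IsDoubling μ) {d ε α p : ℝ} (hd : 1 ≤ d)
    (hε : ε ∈ Set.Icc (0 : ℝ) (1 - 1 / d)) (hα : α = ε * d) (hp : p = d / (1 + ε * d))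
    (hdim : HasLowerDim μ d) (hpoincare : HasPoincare μ p) {φ : X → X → ℝ}
    (hφ : φ = phiVol μ ε ∨ φ = phiMet α) {b : X → ℂ} {b' : X → ℝ} (hb' : LocInt b' μ)
    (hbb' : ∀ x y, ‖b' x - b' y‖ ≤ ‖b x - b y‖)
    (hK : LocInt (fun z : X × X => ‖b z.1 - b z.2‖ ^ p / V μ z.1 z.2 ^ 2 * φ z.1 z.2 ^ p)
      (μ.prod μ)) :
    ∃ c : ℝ, b' =ᵐ[μ] fun _ => c := by
  have hd0 : 0 < d := by linarith
  have hεd : 0 < 1 + ε * d := by have := hε.1; positivity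
  -- The upper bound on `ε` says exactly that `1 + ε d ≤ d`.
  have hp1 : 1 ≤ p := by
    rw [hp, one_le_div hεd]
    have := mul_le_mul_of_nonneg_right hε.2 hd0.le
    rw [sub_mul, one_div, inv_mul_cancel₀ hd0.ne'] at this
    linarith
  have hp0 : 0 < p := by linarith
  have hφ0 : ∀ x y, 0 ≤ φ x y := by
    rcases hφ with rfl | rfl
    · exact phiVol_nonneg ε
    · exact phiMet_nonneg α
  set K : X × X → ℝ := fun z => ‖b z.1 - b z.2‖ ^ p / V μ z.1 z.2 ^ 2 * φ z.1 z.2 ^ p with hKdef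
  have hK0 : ∀ z, 0 ≤ K z := fun z => by
    have := hφ0 z.1 z.2
    positivity
  refine h.exists_ae_eq_const fun x₀ R hR => ⟨_, hpoincare.ae_eq_average_of_tendsto h hp1 hb'
    (t := fun n : ℕ => 1 / ((n : ℝ) + 1)) (fun n => by positivity)
    tendsto_one_div_add_atTop_nhds_zero_nat (fun x₀ R => ?_) x₀ hR⟩
  obtain ⟨A, hA0, hA⟩ := h.exists_V_le hd hε.1 hα hp hdim hφ x₀ (R + 1)
  have hKB : IntegrableOn K (ball x₀ (R + 1) ×ˢ ball x₀ (R + 1)) (μ.prod μ) := by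
    rw [ball_prod_same]
    exact hK _ _
  refine h.tendsto_lintegral_meanDist hb' hp1 (g := fun z => ENNReal.ofReal (K z))
    (fun x => by simp [hKdef, hp0.ne']) (x₀ := x₀) (R := R)
    hKB.aestronglyMeasurable.aemeasurable.ennreal_ofReal ?_ (A := NNReal.mk A hA0)
    (fun y hy x hx hxy => ?_) (fun n => by positivity) (fun n => ?_)
    tendsto_one_div_add_atTop_nhds_zero_nat
  · exact ((hasFiniteIntegral_iff_ofReal (ae_of_all _ hK0)).1 hKB.hasFiniteIntegral).ne
  · have hcoe : ((NNReal.mk A hA0 : ℝ≥0) : ℝ≥0∞) = ENNReal.ofReal A :=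
      (ENNReal.ofReal_eq_coe_nnreal hA0).symm
    have hv := h.V_pos hxy.symm
    have hμ : μ (ball y (dist x y)) = ENNReal.ofReal (V μ y x) := by
      rw [V_of_ne hxy.symm, ofReal_measureReal (h.measure_ball_lt_top _ _).ne, dist_comm x y]
    have hdp : 0 ≤ dist x y ^ p := by positivity
    rw [hcoe, hμ, ENNReal.ofReal_rpow_of_nonneg dist_nonneg hp0.le, ← ENNReal.ofReal_mul hdp,
      ← ENNReal.ofReal_mul (hK0 _), ← ENNReal.ofReal_mul hA0, ← ofReal_norm,
      ENNReal.ofReal_rpow_of_nonneg (norm_nonneg _) hp0.le]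
    refine ENNReal.ofReal_le_ofReal ?_
    have hN : ‖b' x - b' y‖ ^ p ≤ ‖b y - b x‖ ^ p := by
      rw [norm_sub_rev (b y)]
      exact Real.rpow_le_rpow (norm_nonneg _) (hbb' x y) hp0.le
    refine hN.trans ?_
    have hNp : 0 ≤ ‖b y - b x‖ ^ p := by positivity
    -- One of the two factors `V⁻¹` in the kernel cancels; the other meets `A (φ ρ)^p`, giving a
    -- quotient that is at least one.
    have hrw : A * (K (y, x) * (dist x y ^ p * V μ y x)) =
        ‖b y - b x‖ ^ p * ((A * φ y x ^ p * dist x y ^ p) / V μ y x) := by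
      simp only [hKdef]
      field_simp
    rw [hrw]
    exact le_mul_of_one_le_right hNp ((one_le_div hv).2 (hA y hy x hx hxy))
  · rw [div_le_one (by positivity)]
    simp

omit [BorelSpace X] in
theorem IsDoubling.aeConstants_subset_spaceB (h : IsDoubling μ) {p : ℝ} (hp : 0 < p)
    (φ : X → X → ℝ) : aeConstants μ ⊆ spaceB μ p φ := by
  rintro b ⟨c, hc⟩
  refine ⟨fun x r => (h.locInt_const c x r).congr (ae_restrict_of_ae hc.symm), ?_⟩
  have h0 : ∫⁻ y, ∫⁻ x, ENNReal.ofReal (‖b x - b y‖ ^ p / V μ x y ^ 2 * φ x y ^ p) ∂μ ∂μ = 0 := by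
    rw [← lintegral_zero (μ := μ)]
    refine lintegral_congr_ae ?_
    filter_upwards [hc] with y hy
    rw [← lintegral_zero (μ := μ)]
    refine lintegral_congr_ae ?_
    filter_upwards [hc] with x hx
    simp [hx, hy, Real.zero_rpow hp.ne']
  rw [normB, h0, ENNReal.zero_rpow_of_pos (by positivity)]
  exact ENNReal.zero_lt_top

omit [BorelSpace X] in
-- Off the diagonal the exponents agree: `ε p - 2 = -(1 + p/d)`. On it both integrands vanish since
-- `0 ^ p = 0`, whatever the value of `V(x,x)`.
theorem IsDoubling.normDotB_eq (h : IsDoubling μ) {d ε p : ℝ} (hp : 0 < p)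
    (hεp : ε * p + p / d = 1) (b : X → ℂ) :
    normDotB μ p (1 / d) b = normB μ p (phiVol μ ε) b := by
  unfold normDotB normB
  congr! 6 with y x
  rcases eq_or_ne x y with rfl | hxy
  · simp [Real.zero_rpow hp.ne']
  · have hv := h.V_pos hxy
    rw [phiVol, ← Real.rpow_mul hv.le, div_mul_eq_mul_div, mul_div_assoc, div_eq_mul_inv,
      ← Real.rpow_neg hv.le, ← Real.rpow_two, ← Real.rpow_sub hv]
    congr 2
    rw [mul_one_div]
    linarith

omit [BorelSpace X] in
theorem normTildeB_eq (p α : ℝ) (b : X → ℂ) :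
    normTildeB μ p α b = normB μ p (phiMet α) b := by
  unfold normTildeB normB phiMet
  simp_rw [← Real.rpow_mul dist_nonneg, mul_comm p α]

end Kernel

end FractionalBesov

/-! ### The main theorem -/

theorem corollary8p2 {X : Type*} [MetricSpace X] [MeasurableSpace X] [BorelSpace X]
    (μ : Measure X) (d ε α p : ℝ)
    (hd : 1 ≤ d) (hε : ε ∈ Set.Icc (0 : ℝ) (1 - 1 / d)) (hα : α = ε * d)
    (hp : p = d / (1 + ε * d))
    (hdoubling : FractionalBesov.IsDoubling μ)
    (hdim : FractionalBesov.HasLowerDim μ d)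
    (hpoincare : FractionalBesov.HasPoincare μ p)
    (φ : X → X → ℝ)
    (hφ : φ = FractionalBesov.phiVol μ ε ∨ φ = FractionalBesov.phiMet α) :
    (∀ b : X → ℂ, FractionalBesov.LocInt b μ →
      FractionalBesov.LocInt
        (fun z : X × X =>
          ‖b z.1 - b z.2‖ ^ p / FractionalBesov.V μ z.1 z.2 ^ 2 * φ z.1 z.2 ^ p)
        (μ.prod μ) →
      ∃ c : ℂ, b =ᵐ[μ] fun _ => c) ∧
    FractionalBesov.spaceB μ p φ = FractionalBesov.aeConstants μ ∧
    FractionalBesov.spaceDotB μ p (1 / d) = FractionalBesov.aeConstants μ ∧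
    FractionalBesov.spaceTildeB μ p α = FractionalBesov.aeConstants μ := by
  have hd0 : 0 < d := by linarith
  have hεd : 0 < 1 + ε * d := by have := hε.1; positivity
  have hp0 : 0 < p := by rw [hp]; positivity
  have hεp : ε * p + p / d = 1 := by rw [hp]; field_simp; ring
  have := hdoubling.secondCountableTopology
  have := hdoubling.sigmaFinite
  -- Stated for every admissible weight, because the last two spaces need the volumic and the metric
  -- weight regardless of the given `φ`.
  have hconst : ∀ φ : X → X → ℝ,
      φ = FractionalBesov.phiVol μ ε ∨ φ = FractionalBesov.phiMet α →
      ∀ b : X → ℂ, FractionalBesov.LocInt b μ →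
      FractionalBesov.LocInt
        (fun z : X × X =>
          ‖b z.1 - b z.2‖ ^ p / FractionalBesov.V μ z.1 z.2 ^ 2 * φ z.1 z.2 ^ p)
        (μ.prod μ) →
      ∃ c : ℂ, b =ᵐ[μ] fun _ => c := by
    intro φ hφ b hb hK
    obtain ⟨c₁, hc₁⟩ := hdoubling.ae_const_of_kernel hd hε hα hp hdim hpoincare hφ
      (b' := fun x => (b x).re) (fun x r => (hb x r).re)
      (fun x y => by simpa using Complex.abs_re_le_norm (b x - b y)) hK
    obtain ⟨c₂, hc₂⟩ := hdoubling.ae_const_of_kernel hd hε hα hp hdim hpoincare hφ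
      (b' := fun x => (b x).im) (fun x r => (hb x r).im)
      (fun x y => by simpa using Complex.abs_im_le_norm (b x - b y)) hK
    refine ⟨⟨c₁, c₂⟩, ?_⟩
    filter_upwards [hc₁, hc₂] with x h₁ h₂
    exact Complex.ext h₁ h₂
  have hspace : ∀ φ : X → X → ℝ,
      φ = FractionalBesov.phiVol μ ε ∨ φ = FractionalBesov.phiMet α →
      FractionalBesov.spaceB μ p φ = FractionalBesov.aeConstants μ := by
    intro φ hφ
    refine Set.Subset.antisymm (fun b hb => hconst φ hφ b hb.1 ?_)
      (hdoubling.aeConstants_subset_spaceB hp0 φ)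
    refine hdoubling.locInt_kernel hp0 ?_ ?_ hb.1 hb.2
    · rcases hφ with rfl | rfl
      · exact FractionalBesov.phiVol_nonneg ε
      · exact FractionalBesov.phiMet_nonneg α
    · rcases hφ with rfl | rfl
      · exact FractionalBesov.measurable_V.pow_const ε
      · exact measurable_dist.pow_const α
  refine ⟨hconst φ hφ, hspace φ hφ, ?_, ?_⟩
  · rw [← hspace _ (Or.inl rfl)]
    simp only [FractionalBesov.spaceDotB, FractionalBesov.spaceB,
      hdoubling.normDotB_eq hp0 hεp]
  · rw [← hspace _ (Or.inr rfl)]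
    simp only [FractionalBesov.spaceTildeB, FractionalBesov.spaceB,
      FractionalBesov.normTildeB_eq]
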